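/- **Setting.** Let $N,n\ge 0$ be integers, $x=(x_1,\dots,x_N)$ variables and $a=(a_1,\dots,a_n)$ further variables, called parameters. Let $F=(f_1,\dots,f_N)$, $f_i\in\mathbb R[x]$, be a polynomial vector field. For $x_0\in\mathbb R^N$ consider the solution of $\dot x=F(x)$, $x(0)=x_0$, near $t=0$; let $D_{x_0}$ be the largest symmetric open interval around $0$ on which the Taylor expansions from $0$ of all its components converge, and let $x(t;x_0)$, $t\in D_{x_0}$, be the trajectory given by these expansions. For $P\subseteq\mathbb R[x]$ let $\mathbf V(P)\subseteq\mathbb R^N$ be the set of common real zeros of $P$; sets of this form are called algebraic varieties. For $A\subseteq \mathbb R^N$ let $\mathbf I(A)\subseteq\mathbb R[x]$ be the ideal of polynomials vanishing on $A$. For $\psi,\phi\subseteq\mathbb R^N$ write $\psi\to[F]\phi$ if $x(t;x_0)\in\phi$ for all $x_0\in\psi$ and all $t\in D_{x_0}$. The weakest algebraic precondition $\psi_\phi$ is the largest algebraic variety $\psi$ (with respect to inclusion) such that $\psi\to[F]\phi$. A template is a polynomial $\pi\in\mathbb R[a,x]$ whose coefficients, as a polynomial in $x$, are linear expressions in $a$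 without constant term. For $v\in\mathbb R^n$ let $\pi[v]\in\mathbb R[x]$ be the result of substituting $v$ for $a$, and for $S\subseteq\mathbb R^n$ let $\pi[S]=\{\pi[v]:v\in S\}$. Let $\pi^{(0)}=\pi$ and $\pi^{(j+1)}=\sum_{i=1}^N f_i\,\partial\pi^{(j)}/\partial x_i$. **The algorithm.** Fix on $\mathbb R[a,x]$ a monomial order that is an elimination order for the parameters (every monomial in which some $a_i$ occurs is greater than every monomial in $x$ only; for instance a lexicographic order with all $a_i>x_j$), and on $\mathbb R[x]$ its restriction. For an algebraic variety $\psi_0$ let $G\subseteq \mathbb R[x]$ be a Gröbner basis of $\mathbf I(\psi_0)$, let $r_j=\pi^{(j)}\bmod G$ be the remainder of the division of $\pi^{(j)}$ by $G$ in $\mathbb R[a,x]$, and for $i\ge 0$ put $$V_i=\{v\in\mathbb R^n: r_j[v]=0\text{ for }j=0,\dots,i\},\qquad J_i=\Big\langle \bigcup_{j=0}^i\pi^{(j)}[V_i]\Big\rangle\subseteq\mathbb R[x].$$ Then $\mathrm{POST}(\psi_0,\pi)=(V_k,J_k)$, where $k$ is the least index such that both $V_{k+1}=V_k$ and $J_{k+1}=J_k$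 (such an index exists). **Theorem (weakest precondition via POST).** For every algebraic variety $\psi_0$ and every template $\pi$, let $\mathrm{POST}(\psi_0,\pi)=(V,J)$ and $\phi=\mathbf V(\pi[V])$. Then $\mathbf V(J)=\psi_\phi$; that is, $\mathbf V(J)$ is an algebraic variety, $\mathbf V(J)\to[F]\phi$, and every algebraic variety $\psi$ with $\psi\to[F]\phi$ is contained in $\mathbf V(J)$. -/

import Mathlib

open MvPolynomial
open scoped MonomialOrder

noncomputable section

namespace PolyODE

/-! ### Polynomial vector fields and their time trajectories -/

/-- The map `ℝᴺ → ℝᴺ` induced by a polynomial vector field `F = (f₁, …, f_N)`. -/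
def fieldMap {N : ℕ} (F : Fin N → MvPolynomial (Fin N) ℝ) (x : Fin N → ℝ) : Fin N → ℝ :=
  fun i => eval x (F i)

/-- `y` solves `ẏ = F(y)`, `y(0) = x₀` on the open interval `(-ε, ε)`, for some `ε > 0`. -/
def IsLocalSolution {N : ℕ} (F : Fin N → MvPolynomial (Fin N) ℝ) (x₀ : Fin N → ℝ)
    (y : ℝ → Fin N → ℝ) : Prop :=
  y 0 = x₀ ∧ ∃ ε > (0 : ℝ), ∀ t ∈ Set.Ioo (-ε) ε, HasDerivAt y (fieldMap F (y t)) t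

theorem exists_isLocalSolution {N : ℕ} (F : Fin N → MvPolynomial (Fin N) ℝ) (x₀ : Fin N → ℝ) :
    ∃ y, IsLocalSolution F x₀ y := by
  have hpoly : ∀ p : MvPolynomial (Fin N) ℝ,
      ContDiff ℝ 1 (fun x : Fin N → ℝ => eval x p) := by
    intro p
    induction p using MvPolynomial.induction_on with
    | C a => simpa using contDiff_const
    | add p q hp hq => simpa using hp.add hq
    | mul_X p i hp => simpa using hp.mul (contDiff_apply ℝ ℝ i)
  have hF : ContDiff ℝ 1 (fieldMap F) := contDiff_pi.2 fun i => hpoly (F i)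
  obtain ⟨y, hy0, ε, hε, hy⟩ :=
    hF.contDiffAt.exists_forall_mem_closedBall_exists_eq_forall_mem_Ioo_hasDerivAt₀
      (x₀ := x₀) (0 : ℝ)
  exact ⟨y, hy0, ε, hε, by simpa using hy⟩

/-- The solution of the initial value problem near time `0` (its germ at `0` is unique). -/
def localSolution {N : ℕ} (F : Fin N → MvPolynomial (Fin N) ℝ) (x₀ : Fin N → ℝ) :
    ℝ → Fin N → ℝ :=
  Classical.choose (exists_isLocalSolution F x₀)

/-- The `k`-th coefficient of the Taylor expansion from `0` of the `i`-th component `xᵢ(t)`. -/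
def taylorCoeff {N : ℕ} (F : Fin N → MvPolynomial (Fin N) ℝ) (x₀ : Fin N → ℝ)
    (i : Fin N) (k : ℕ) : ℝ :=
  iteratedDeriv k (fun t => localSolution F x₀ t i) 0 / (k.factorial : ℝ)

/-- The domain of definition `D_{x₀}`: the largest symmetric open interval on which the Taylor
expansions from `0` of all the components `xᵢ(t)` converge. -/
def timeDomain {N : ℕ} (F : Fin N → MvPolynomial (Fin N) ℝ) (x₀ : Fin N → ℝ) : Set ℝ :=
  {t | ENNReal.ofReal |t| < ⨅ i, (FormalMultilinearSeries.ofScalars ℝ (taylorCoeff F x₀ i)).radius}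

/-- The time trajectory `x(t; x₀)`, given on `timeDomain F x₀` by the Taylor expansions. -/
def trajectory {N : ℕ} (F : Fin N → MvPolynomial (Fin N) ℝ) (x₀ : Fin N → ℝ) (t : ℝ) :
    Fin N → ℝ :=
  fun i => ∑' k : ℕ, taylorCoeff F x₀ i k * t ^ k

/-! ### Varieties and safety assertions -/

/-- The real algebraic variety `V(P)` of a set of polynomials `P`. -/
def variety {N : ℕ} (P : Set (MvPolynomial (Fin N) ℝ)) : Set (Fin N → ℝ) :=
  {x | ∀ p ∈ P, eval x p = 0}

def IsAlgebraicVariety {N : ℕ} (A : Set (Fin N → ℝ)) : Prop :=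
  ∃ P : Set (MvPolynomial (Fin N) ℝ), A = variety P

/-- The safety assertion `ψ ⟶ [F] φ`. -/
def Safe {N : ℕ} (F : Fin N → MvPolynomial (Fin N) ℝ) (ψ φ : Set (Fin N → ℝ)) : Prop :=
  ∀ x₀ ∈ ψ, ∀ t ∈ timeDomain F x₀, trajectory F x₀ t ∈ φ

/-- `ψ` is the weakest precondition of `φ`: the largest algebraic variety `ψ` with
`ψ ⟶ [F] φ`. -/
def IsWeakestPrecondition {N : ℕ} (F : Fin N → MvPolynomial (Fin N) ℝ)
    (φ ψ : Set (Fin N → ℝ)) : Prop :=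
  IsGreatest {χ | IsAlgebraicVariety χ ∧ Safe F χ φ} ψ

/-! ### Division with remainder and Gröbner bases -/

/-- `r` is a remainder of the multivariate division of `p` by the finite set `G`. -/
def IsRemainder {σ : Type*} (m : MonomialOrder σ) (G : Set (MvPolynomial σ ℝ))
    (p r : MvPolynomial σ ℝ) : Prop :=
  ∃ q : G →₀ MvPolynomial σ ℝ,
    p = (q.sum fun g h => h * (g : MvPolynomial σ ℝ)) + r ∧
    (∀ g : G, m.degree (q g * (g : MvPolynomial σ ℝ)) ≼[m] m.degree p) ∧
    ∀ c ∈ r.support, ∀ g ∈ G, g ≠ 0 → ¬ m.degree g ≤ c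

theorem exists_isRemainder {σ : Type*} (m : MonomialOrder σ) (G : Set (MvPolynomial σ ℝ))
    (p : MvPolynomial σ ℝ) : ∃ r, IsRemainder m G p r := by
  classical
  obtain ⟨q, r, h1, h2, h3⟩ := m.div_set (B := G \ {0})
    (fun b hb => (MonomialOrder.leadingCoeff_ne_zero_iff.2 hb.2).isUnit) p
  let ι : (G \ {0} : Set (MvPolynomial σ ℝ)) ↪ G :=
    ⟨fun b => ⟨b.1, b.2.1⟩, fun a b h => Subtype.ext (by simpa using h)⟩
  refine ⟨r, q.embDomain ι, ?_, ?_, ?_⟩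
  · rw [Finsupp.sum_embDomain, h1, Finsupp.linearCombination_apply]
    rfl
  · intro g
    by_cases hg : g.1 = 0
    · simp [hg]
    · have := h2 ⟨g.1, g.2, hg⟩
      have e : (q.embDomain ι) g = q ⟨g.1, g.2, hg⟩ :=
        Finsupp.embDomain_apply_self ι q ⟨g.1, g.2, hg⟩
      rw [e, mul_comm]
      exact this
  · exact fun c hc g hg hg0 => h3 c hc g ⟨hg, hg0⟩

/-- The remainder `p mod G` (uniquely determined when `G` is a Gröbner basis). -/
def polyMod {σ : Type*} (m : MonomialOrder σ) (G : Set (MvPolynomial σ ℝ))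
    (p : MvPolynomial σ ℝ) : MvPolynomial σ ℝ :=
  Classical.choose (exists_isRemainder m G p)

/-- `G` is a Gröbner basis of `I`: a finite basis such that a polynomial belongs to `I` if and
only if its remainder (with whatever choices in the division) is zero. -/
def IsGroebnerBasis {σ : Type*} (m : MonomialOrder σ) (G : Set (MvPolynomial σ ℝ))
    (I : Ideal (MvPolynomial σ ℝ)) : Prop :=
  G.Finite ∧ Ideal.span G = I ∧ ∀ p r, IsRemainder m G p r → (p ∈ I ↔ r = 0)

/-- Monomial orders `m` of `ℝ[a,x]` and `mx` of `ℝ[x]` such that `mx` is the restriction of `m`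
and `m` is an elimination order for the parameters `a`: every monomial in which some parameter
occurs is greater than every monomial in `x` only. -/
def IsEliminationOrder {n N : ℕ} (m : MonomialOrder (Fin n ⊕ Fin N))
    (mx : MonomialOrder (Fin N)) : Prop :=
  (∀ α β : Fin N →₀ ℕ, α ≼[mx] β ↔ α.mapDomain Sum.inr ≼[m] β.mapDomain Sum.inr) ∧
  ∀ α β : Fin n ⊕ Fin N →₀ ℕ, (∃ i, α (Sum.inl i) ≠ 0) → (∀ i, β (Sum.inl i) = 0) → β ≺[m] α

/-! ### Templates and the `POST` algorithm -/

/-- A template with parameters `a₁, …, aₙ`: a polynomial in `ℝ[a,x]` whose coefficients, as a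
polynomial in `x`, are linear expressions in `a` without constant term. -/
def IsTemplate {n N : ℕ} (π : MvPolynomial (Fin n ⊕ Fin N) ℝ) : Prop :=
  ∀ d ∈ π.support, ∑ i, d (Sum.inl i) = 1

/-- `π[v]`: replace every parameter `aᵢ` by the real number `vᵢ`. -/
def subst {n N : ℕ} (π : MvPolynomial (Fin n ⊕ Fin N) ℝ) (v : Fin n → ℝ) :
    MvPolynomial (Fin N) ℝ :=
  aeval (Sum.elim (fun i => C (v i)) X) π

/-- The Lie derivative along `F` on `ℝ[a,x]`, with the parameters treated as constants. -/
def lieTemplate {n N : ℕ} (F : Fin N → MvPolynomial (Fin N) ℝ)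
    (π : MvPolynomial (Fin n ⊕ Fin N) ℝ) : MvPolynomial (Fin n ⊕ Fin N) ℝ :=
  ∑ i, pderiv (Sum.inr i) π * rename Sum.inr (F i)

/-- `r_j = π⁽ʲ⁾ mod G`, computed in `ℝ[a,x]`. -/
def templateRemainder {n N : ℕ} (F : Fin N → MvPolynomial (Fin N) ℝ)
    (m : MonomialOrder (Fin n ⊕ Fin N)) (G : Set (MvPolynomial (Fin N) ℝ))
    (π : MvPolynomial (Fin n ⊕ Fin N) ℝ) (j : ℕ) : MvPolynomial (Fin n ⊕ Fin N) ℝ :=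
  polyMod m (rename Sum.inr '' G) ((lieTemplate F)^[j] π)

/-- The sets `V_i` of parameter valuations. -/
def paramSpace {n N : ℕ} (F : Fin N → MvPolynomial (Fin N) ℝ)
    (m : MonomialOrder (Fin n ⊕ Fin N)) (G : Set (MvPolynomial (Fin N) ℝ))
    (π : MvPolynomial (Fin n ⊕ Fin N) ℝ) (i : ℕ) : Set (Fin n → ℝ) :=
  {v | ∀ j ≤ i, subst (templateRemainder F m G π j) v = 0}

/-- The ideals `J_i`, generated by `π⁽⁰⁾[V_i] ∪ … ∪ π⁽ⁱ⁾[V_i]`. -/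
def idealChain {n N : ℕ} (F : Fin N → MvPolynomial (Fin N) ℝ)
    (m : MonomialOrder (Fin n ⊕ Fin N)) (G : Set (MvPolynomial (Fin N) ℝ))
    (π : MvPolynomial (Fin n ⊕ Fin N) ℝ) (i : ℕ) : Ideal (MvPolynomial (Fin N) ℝ) :=
  Ideal.span (⋃ j ≤ i, subst ((lieTemplate F)^[j] π) '' paramSpace F m G π i)

theorem coeff_subst {n N : ℕ} (π : MvPolynomial (Fin n ⊕ Fin N) ℝ) (c : Fin N →₀ ℕ) :
    ∃ q : MvPolynomial (Fin n) ℝ, ∀ v, coeff c (subst π v) = eval v q := by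
  let π' : MvPolynomial (Fin N) (MvPolynomial (Fin n) ℝ) :=
    aeval (Sum.elim (fun i => C (X i)) X) π
  refine ⟨coeff c π', fun v => ?_⟩
  rw [← coeff_map]
  congr 1
  simp only [π', subst]
  clear π'
  induction π using MvPolynomial.induction_on with
  | C a => simp [algebraMap_eq, MvPolynomial.algebraMap_apply]
  | add p q hp hq => rw [map_add, map_add, map_add, hp, hq]
  | mul_X p i hp =>
    rw [map_mul, map_mul, map_mul, hp]
    rcases i with i | i <;> simp

theorem paramSpace_antitone {n N : ℕ} (F : Fin N → MvPolynomial (Fin N) ℝ)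
    (m : MonomialOrder (Fin n ⊕ Fin N)) (G : Set (MvPolynomial (Fin N) ℝ))
    (π : MvPolynomial (Fin n ⊕ Fin N) ℝ) : Antitone (paramSpace F m G π) :=
  fun _ _ h _ hv j hj => hv j (hj.trans h)

/-- The stopping condition of `POST` is eventually met. -/
theorem exists_stop {n N : ℕ} (F : Fin N → MvPolynomial (Fin N) ℝ)
    (m : MonomialOrder (Fin n ⊕ Fin N)) (G : Set (MvPolynomial (Fin N) ℝ))
    (π : MvPolynomial (Fin n ⊕ Fin N) ℝ) :
    ∃ k, paramSpace F m G π (k + 1) = paramSpace F m G π k ∧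
      idealChain F m G π (k + 1) = idealChain F m G π k := by
  have hanti := paramSpace_antitone F m G π
  let I : ℕ →o Ideal (MvPolynomial (Fin n) ℝ) :=
    ⟨fun k => vanishingIdeal ℝ (paramSpace F m G π k), fun a b h p hp x hx => hp x (hanti h hx)⟩
  obtain ⟨k₀, hk₀⟩ := monotone_stabilizes_iff_noetherian.2
    (inferInstance : IsNoetherian (MvPolynomial (Fin n) ℝ) (MvPolynomial (Fin n) ℝ)) I
  have hV : ∀ k, k₀ ≤ k → paramSpace F m G π k = paramSpace F m G π k₀ := by
    intro k hk
    refine (hanti hk).antisymm fun v hv j hj => ?_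
    ext c
    obtain ⟨q, hq⟩ := coeff_subst (templateRemainder F m G π j) c
    have hmem : q ∈ I k := by
      intro w hw
      rw [aeval_eq_eval, ← hq w, hw j hj, coeff_zero]
    rw [← hk₀ k hk] at hmem
    have := hmem v hv
    rw [aeval_eq_eval] at this
    rw [hq v, this, coeff_zero]
  let J : ℕ →o Ideal (MvPolynomial (Fin N) ℝ) :=
    ⟨fun k => idealChain F m G π (k₀ + k), fun a b h => by
      refine Ideal.span_mono ?_
      rw [hV _ (Nat.le_add_right k₀ a), hV _ (Nat.le_add_right k₀ b)]
      exact Set.biUnion_mono (fun j (hj : j ≤ k₀ + a) => show j ≤ k₀ + b by omega)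
        fun _ _ => le_rfl⟩
  obtain ⟨k₁, hk₁⟩ := monotone_stabilizes_iff_noetherian.2
    (inferInstance : IsNoetherian (MvPolynomial (Fin N) ℝ) (MvPolynomial (Fin N) ℝ)) J
  refine ⟨k₀ + k₁, ?_, (hk₁ (k₁ + 1) (Nat.le_succ _)).symm⟩
  rw [hV _ (by omega), hV (k₀ + k₁) (by omega)]

open Classical in
/-- The result `(V, J)` of `POST`, for a Gröbner basis `G` of the ideal of the precondition and
a template `π`: the pair `(V_k, J_k)` for the least `k` with `V_{k+1} = V_k` and
`J_{k+1} = J_k`. -/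
def post {n N : ℕ} (F : Fin N → MvPolynomial (Fin N) ℝ)
    (m : MonomialOrder (Fin n ⊕ Fin N)) (G : Set (MvPolynomial (Fin N) ℝ))
    (π : MvPolynomial (Fin n ⊕ Fin N) ℝ) :
    Set (Fin n → ℝ) × Ideal (MvPolynomial (Fin N) ℝ) :=
  (paramSpace F m G π (Nat.find (exists_stop F m G π)),
    idealChain F m G π (Nat.find (exists_stop F m G π)))

end PolyODE

end

/-!
Along the trajectory through `x₀`, a polynomial `p` is the sum of its Lie series
`∑ (Lᵏp)(x₀) tᵏ / k!`, where `L` is the Lie derivative along `F` (`eval_trajectory`). The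
coefficients `lieJet F x₀ k p` are those of the Taylor expansion when `p` is a coordinate
(`taylorCoeff_eq_lieJet`), and the Leibniz rule turns products of polynomials into Cauchy products
of series, so no further facts on differential equations are needed. A majorant estimate
(`abs_eval_iterate_monomial_le`) bounds the coefficients geometrically, so the time domain contains
a neighbourhood of `0`, and uniqueness of power series gives the criterion
`forall_eval_trajectory_eq_zero_iff`: `p` vanishes along the trajectory if and only if all `Lᵏp`
vanish at `x₀`.

It remains to compare this with the ideal `J = J_k` at a stopping index `k`. Since `V_{k+1} = V_k`,
the Lie derivative maps the generators of `J_k` to generators of `J_{k+1} = J_k`, so `J` is closed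
under `L` (`lieDerivation_mem_idealChain`). As `J` contains `π[v]` for `v ∈ V`, it contains all
`Lʲ(π[v])`, so by the criterion `V(J) ⟶ [F] φ`. Conversely the generators of `J` are of the form
`Lʲ(π[v])` with `v ∈ V`, and by the criterion these vanish at every point of a set `ψ` with
`ψ ⟶ [F] φ`.
-/

namespace PolyODE

section Flow

variable {N : ℕ} (F : Fin N → MvPolynomial (Fin N) ℝ) (x₀ : Fin N → ℝ)

/-! ### Lie derivatives and their Taylor jets -/

/-- The Lie derivative `p ↦ ∑ᵢ fᵢ ∂p/∂xᵢ` along `F`, as the derivation sending `xᵢ` to `fᵢ`. -/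
noncomputable def lieDerivation : Derivation ℝ (MvPolynomial (Fin N) ℝ) (MvPolynomial (Fin N) ℝ) :=
  mkDerivation ℝ F

/-- The functional `p ↦ (Lᵏp)(x₀) / k!`, with `L` the Lie derivative along `F`: formally, the
`k`-th Taylor coefficient at time `0` of `p` along the trajectory through `x₀`. -/
noncomputable def lieJet (k : ℕ) : MvPolynomial (Fin N) ℝ →ₗ[ℝ] ℝ :=
  (k.factorial : ℝ)⁻¹ • (aeval x₀).toLinearMap ∘ₗ ((lieDerivation F : _ →ₗ[ℝ] _) ^ k)

theorem lieJet_apply (k : ℕ) (p : MvPolynomial (Fin N) ℝ) :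
    lieJet F x₀ k p = eval x₀ ((lieDerivation F)^[k] p) / k.factorial := by
  simp [lieJet, Module.End.pow_apply, div_eq_inv_mul, aeval_eq_eval]

theorem lieJet_eq_zero_iff (k : ℕ) (p : MvPolynomial (Fin N) ℝ) :
    lieJet F x₀ k p = 0 ↔ eval x₀ ((lieDerivation F)^[k] p) = 0 := by
  simp [lieJet_apply, Nat.factorial_ne_zero]

theorem lieJet_C (k : ℕ) (a : ℝ) : lieJet F x₀ k (C a) = if k = 0 then a else 0 := by
  rcases k with _ | k
  · simp [lieJet_apply]
  · have h : lieDerivation F (C a) = 0 := by simp [lieDerivation, derivation_C]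
    simp [lieJet_apply, Function.iterate_succ_apply, h, iterate_map_zero]

theorem iterate_lieDerivation_mul (k : ℕ) (p q : MvPolynomial (Fin N) ℝ) :
    (lieDerivation F)^[k] (p * q) = ∑ ij ∈ Finset.HasAntidiagonal.antidiagonal k,
      k.choose ij.1 • ((lieDerivation F)^[ij.1] p * (lieDerivation F)^[ij.2] q) := by
  induction k with
  | zero => simp
  | succ k ih =>
    rw [Finset.sum_antidiagonal_choose_succ_nsmul
      (fun i j => (lieDerivation F)^[i] p * (lieDerivation F)^[j] q) k]
    simp only [Function.iterate_succ_apply', ih, map_sum, map_nsmul, Derivation.leibniz,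
      smul_eq_mul, smul_add, Finset.sum_add_distrib]
    congr 1
    refine Finset.sum_congr rfl fun ⟨i, j⟩ hij => ?_
    rw [k.choose_symm_of_eq_add (Finset.HasAntidiagonal.mem_antidiagonal.1 hij).symm, mul_comm]

theorem lieJet_mul (k : ℕ) (p q : MvPolynomial (Fin N) ℝ) :
    lieJet F x₀ k (p * q) =
      ∑ ij ∈ Finset.HasAntidiagonal.antidiagonal k, lieJet F x₀ ij.1 p * lieJet F x₀ ij.2 q := by
  simp only [lieJet_apply, iterate_lieDerivation_mul, map_sum, map_nsmul, map_mul,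
    Finset.sum_div]
  refine Finset.sum_congr rfl fun ⟨i, j⟩ hij => ?_
  obtain rfl := Finset.HasAntidiagonal.mem_antidiagonal.1 hij
  have h := Nat.add_choose_mul_factorial_mul_factorial i j
  have h' : ((i + j).choose i : ℝ) * i.factorial * j.factorial = (i + j).factorial := by
    rw [Nat.choose_symm_add]
    exact_mod_cast h
  simp only [nsmul_eq_mul, ← h']
  have hi : (i.factorial : ℝ) ≠ 0 := by positivity
  have hj : (j.factorial : ℝ) ≠ 0 := by positivity
  have hc : ((i + j).choose i : ℝ) ≠ 0 := by
    exact_mod_cast (Nat.choose_pos (Nat.le_add_right i j)).ne'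
  field_simp

/-! ### Taylor coefficients of the solution -/

theorem hasDerivAt_eval_comp {y : ℝ → Fin N → ℝ} {t : ℝ}
    (hy : HasDerivAt y (fieldMap F (y t)) t) (p : MvPolynomial (Fin N) ℝ) :
    HasDerivAt (fun s => eval (y s) p) (eval (y t) (lieDerivation F p)) t := by
  induction p using MvPolynomial.induction_on with
  | C a => simpa [lieDerivation, derivation_C] using hasDerivAt_const t a
  | add p q hp hq =>
    simp only [map_add]
    exact hp.add hq
  | mul_X p i hp =>
    have h := hp.mul (hasDerivAt_pi.1 hy i)
    simp only [map_mul, eval_X, Derivation.leibniz, map_add, smul_eq_mul]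
    refine h.congr_deriv ?_
    simp [lieDerivation, mkDerivation_X, fieldMap]
    ring

/-- The bound on `t` is part of the induction: differentiating the formula for order `k` at a point
needs it on a neighbourhood. -/
theorem iteratedDeriv_eval_comp {y : ℝ → Fin N → ℝ} {ε : ℝ}
    (hy : ∀ t ∈ Set.Ioo (-ε) ε, HasDerivAt y (fieldMap F (y t)) t)
    (p : MvPolynomial (Fin N) ℝ) (k : ℕ) : ∀ t ∈ Set.Ioo (-ε) ε,
      iteratedDeriv k (fun s => eval (y s) p) t = eval (y t) ((lieDerivation F)^[k] p) := by
  induction k with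
  | zero => simp
  | succ k ih =>
    intro t ht
    have h : iteratedDeriv k (fun s => eval (y s) p) =ᶠ[nhds t]
        fun s => eval (y s) ((lieDerivation F)^[k] p) := by
      filter_upwards [Ioo_mem_nhds ht.1 ht.2] with s hs using ih s hs
    rw [iteratedDeriv_succ, h.deriv_eq, Function.iterate_succ_apply']
    exact (hasDerivAt_eval_comp F (hy t ht) _).deriv

theorem taylorCoeff_eq_lieJet (i : Fin N) (k : ℕ) :
    taylorCoeff F x₀ i k = lieJet F x₀ k (X i) := by
  obtain ⟨h0, ε, hε, hy⟩ := Classical.choose_spec (exists_isLocalSolution F x₀)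
  have h := iteratedDeriv_eval_comp F hy (X i) k 0 ⟨by linarith, hε⟩
  rw [h0] at h
  simp only [eval_X] at h
  rw [lieJet_apply, taylorCoeff, ← h]
  rfl

/-! ### Polynomials along the trajectory -/

variable {F x₀}

theorem summable_norm_lieJet {t : ℝ} (ht : t ∈ timeDomain F x₀) (p : MvPolynomial (Fin N) ℝ) :
    Summable fun k => ‖lieJet F x₀ k p * t ^ k‖ := by
  induction p using MvPolynomial.induction_on with
  | C a =>
    refine summable_of_ne_finset_zero (s := {0}) fun k hk => ?_
    simp [lieJet_C, Finset.notMem_singleton.1 hk]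
  | add p q hp hq =>
    refine (hp.add hq).of_nonneg_of_le (fun _ => norm_nonneg _) fun k => ?_
    rw [map_add, add_mul]
    exact norm_add_le _ _
  | mul_X p i hp =>
    have hX : Summable fun k => ‖lieJet F x₀ k (X i) * t ^ k‖ := by
      have h : ((Real.nnabs t : NNReal) : ENNReal) <
          (FormalMultilinearSeries.ofScalars ℝ (taylorCoeff F x₀ i)).radius := by
        rw [← Real.toNNReal_abs]
        exact lt_of_lt_of_le ht (iInf_le _ i)
      simpa [FormalMultilinearSeries.ofScalars_norm, taylorCoeff_eq_lieJet] using
        FormalMultilinearSeries.summable_norm_mul_pow _ h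
    refine (summable_norm_sum_mul_antidiagonal_of_summable_norm hp hX).congr fun k => ?_
    rw [lieJet_mul, Finset.sum_mul]
    congr 1
    refine Finset.sum_congr rfl fun ij hij => ?_
    rw [← Finset.HasAntidiagonal.mem_antidiagonal.1 hij, pow_add]
    ring

/-- Along the trajectory, every polynomial is the sum of its Lie series: a polynomial is built from
the coordinates by sums and products, and the product of two Lie series is their Cauchy product
by the Leibniz rule. -/
theorem eval_trajectory {t : ℝ} (ht : t ∈ timeDomain F x₀) (p : MvPolynomial (Fin N) ℝ) :
    eval (trajectory F x₀ t) p = ∑' k, lieJet F x₀ k p * t ^ k := by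
  induction p using MvPolynomial.induction_on with
  | C a =>
    rw [tsum_eq_single 0 fun k (hk : k ≠ 0) => by simp [lieJet_C, hk]]
    simp [lieJet_C]
  | add p q hp hq =>
    simp only [map_add, add_mul, hp, hq]
    exact ((summable_norm_lieJet ht p).of_norm.tsum_add (summable_norm_lieJet ht q).of_norm).symm
  | mul_X p i hp =>
    have hX : trajectory F x₀ t i = ∑' k, lieJet F x₀ k (X i) * t ^ k := by
      simp only [trajectory, taylorCoeff_eq_lieJet]
    rw [map_mul, eval_X, hp, hX, tsum_mul_tsum_eq_tsum_sum_antidiagonal_of_summable_norm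
      (summable_norm_lieJet ht p) (summable_norm_lieJet ht (X i))]
    refine tsum_congr fun k => ?_
    rw [lieJet_mul, Finset.sum_mul]
    refine Finset.sum_congr rfl fun ij hij => ?_
    rw [← Finset.HasAntidiagonal.mem_antidiagonal.1 hij, pow_add]
    ring

/-! ### Convergence of the Taylor series -/

/-- The majorant estimate behind the analyticity of the solution. One Lie derivative turns a
monomial of degree at most `D * d` into a combination of monomials of degree at most `D * (d + 1)`,
whose coefficients have absolute values adding up to at most `D * d * M`. -/
theorem abs_eval_iterate_monomial_le {R M : ℝ} {D : ℕ} (hR : 1 ≤ R) (hx : ∀ i, |x₀ i| ≤ R)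
    (hD : ∀ i, (F i).totalDegree ≤ D) (hM : ∀ i, ∑ u ∈ (F i).support, |coeff u (F i)| ≤ M)
    (hM0 : 0 ≤ M) (k : ℕ) : ∀ (d : ℕ) (s : Fin N →₀ ℕ), s.degree ≤ D * d →
      |(k.factorial : ℝ) * lieJet F x₀ k (monomial s 1)| ≤
        R ^ (D * (d + k)) * (M * D) ^ k * d.ascFactorial k := by
  induction k with
  | zero =>
    intro d s hs
    simp only [lieJet_apply, Function.iterate_zero_apply, eval_monomial, Finsupp.prod]
    simp only [Nat.factorial_zero, Nat.cast_one, one_mul, div_one, Finset.abs_prod, abs_pow,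
      add_zero, pow_zero, mul_one, Nat.ascFactorial_zero]
    calc ∏ i ∈ s.support, |x₀ i| ^ s i ≤ ∏ i ∈ s.support, R ^ s i := by
          gcongr with i; exact hx i
      _ = R ^ s.degree := by rw [Finset.prod_pow_eq_pow_sum, Finsupp.degree_apply]
      _ ≤ R ^ (D * d) := pow_le_pow_right₀ hR hs
  | succ k ih =>
    intro d s hs
    set B : ℝ := R ^ (D * (d + 1 + k)) * (M * D) ^ k * (d + 1).ascFactorial k with hB
    have hB0 : 0 ≤ B := by positivity
    have hstep : ((k + 1).factorial : ℝ) * lieJet F x₀ (k + 1) (monomial s 1) =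
        ∑ i ∈ s.support, (s i : ℝ) * ∑ u ∈ (F i).support, coeff u (F i) *
          ((k.factorial : ℝ) * lieJet F x₀ k (monomial (s - Finsupp.single i 1 + u) 1)) := by
      have h1 : lieDerivation F (monomial s 1) = ∑ i ∈ s.support, ∑ u ∈ (F i).support,
          ((s i : ℝ) * coeff u (F i)) • monomial (s - Finsupp.single i 1 + u) (1 : ℝ) := by
        rw [lieDerivation, mkDerivation_monomial, one_smul, Finsupp.sum]
        refine Finset.sum_congr rfl fun i _ => ?_
        conv_lhs => rw [(F i).as_sum]
        rw [smul_eq_mul, Finset.mul_sum]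
        refine Finset.sum_congr rfl fun u _ => ?_
        rw [monomial_mul, smul_monomial, smul_eq_mul, mul_one]
      have h2 : ((k + 1).factorial : ℝ) * lieJet F x₀ (k + 1) (monomial s 1) =
          (k.factorial : ℝ) * lieJet F x₀ k (lieDerivation F (monomial s 1)) := by
        rw [lieJet_apply, lieJet_apply, Function.iterate_succ_apply]
        have := Nat.factorial_ne_zero k
        have := Nat.factorial_ne_zero (k + 1)
        field_simp
      rw [h2, h1]
      simp only [map_sum, map_smul, smul_eq_mul, Finset.mul_sum]
      refine Finset.sum_congr rfl fun i _ => Finset.sum_congr rfl fun u _ => ?_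
      ring
    have hinner : ∀ i ∈ s.support, |∑ u ∈ (F i).support, coeff u (F i) *
        ((k.factorial : ℝ) * lieJet F x₀ k (monomial (s - Finsupp.single i 1 + u) 1))| ≤
        M * B := by
      intro i _
      calc _ ≤ ∑ u ∈ (F i).support, |coeff u (F i)| * B := by
            refine (Finset.abs_sum_le_sum_abs _ _).trans (Finset.sum_le_sum fun u hu => ?_)
            rw [abs_mul]
            refine mul_le_mul_of_nonneg_left (ih (d + 1) _ ?_) (abs_nonneg _)
            have hu' : u.degree ≤ D := by
              refine le_trans ?_ ((le_totalDegree hu).trans (hD i))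
              rw [Finsupp.degree_apply, Finsupp.sum]
            have hs' : (s - Finsupp.single i 1).degree ≤ s.degree :=
              Finsupp.degree_mono tsub_le_self
            rw [map_add, mul_add, mul_one]
            omega
        _ ≤ M * B := by
            rw [← Finset.sum_mul]
            exact mul_le_mul_of_nonneg_right (hM i) hB0
    rw [hstep]
    calc _ ≤ ∑ i ∈ s.support, (s i : ℝ) * (M * B) := by
          refine (Finset.abs_sum_le_sum_abs _ _).trans (Finset.sum_le_sum fun i hi => ?_)
          rw [abs_mul, Nat.abs_cast]
          exact mul_le_mul_of_nonneg_left (hinner i hi) (Nat.cast_nonneg _)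
      _ = (s.degree : ℝ) * (M * B) := by
          rw [← Finset.sum_mul, Finsupp.degree_apply, Nat.cast_sum]
      _ ≤ ((D * d : ℕ) : ℝ) * (M * B) := by
          have : (s.degree : ℝ) ≤ ((D * d : ℕ) : ℝ) := by exact_mod_cast hs
          gcongr
      _ = _ := by
          have h : (d : ℝ) * (d + 1).ascFactorial k = d.ascFactorial (k + 1) := by
            rw [Nat.ascFactorial_succ]
            exact_mod_cast Nat.succ_ascFactorial d k
          rw [← h, hB, show d + 1 + k = d + (k + 1) by ring]
          push_cast
          ring

variable (F x₀)

/-- The Taylor series of all components converge on a common neighbourhood of `0`, so the time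
domain is not empty. -/
theorem exists_pos_forall_mem_timeDomain :
    ∃ r : ℝ, 0 < r ∧ ∀ t, |t| < r → t ∈ timeDomain F x₀ := by
  -- Bounds `R, D, M ≥ 1` uniform in `i`; the added `1` makes `q` below positive.
  obtain ⟨R, hR, hx⟩ : ∃ R : ℝ, 1 ≤ R ∧ ∀ i, |x₀ i| ≤ R :=
    ⟨1 + ∑ i, |x₀ i|, le_add_of_nonneg_right (Finset.sum_nonneg fun i _ => abs_nonneg _),
      fun i => (Finset.single_le_sum (f := fun i => |x₀ i|) (fun i _ => abs_nonneg _)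
        (Finset.mem_univ i)).trans (le_add_of_nonneg_left zero_le_one)⟩
  obtain ⟨D, hD1, hD⟩ : ∃ D : ℕ, 1 ≤ D ∧ ∀ i, (F i).totalDegree ≤ D :=
    ⟨1 + ∑ i, (F i).totalDegree, Nat.le_add_right _ _,
      fun i => (Finset.single_le_sum (f := fun i => (F i).totalDegree) (fun i _ => Nat.zero_le _)
        (Finset.mem_univ i)).trans (Nat.le_add_left _ _)⟩
  obtain ⟨M, hM1, hM⟩ : ∃ M : ℝ, 1 ≤ M ∧ ∀ i, ∑ u ∈ (F i).support, |coeff u (F i)| ≤ M := by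
    have h0 : ∀ i ∈ Finset.univ, 0 ≤ ∑ u ∈ (F i).support, |coeff u (F i)| :=
      fun i _ => Finset.sum_nonneg fun u _ => abs_nonneg _
    exact ⟨1 + ∑ i, ∑ u ∈ (F i).support, |coeff u (F i)|,
      le_add_of_nonneg_right (Finset.sum_nonneg h0),
      fun i => (Finset.single_le_sum h0 (Finset.mem_univ i)).trans
        (le_add_of_nonneg_left zero_le_one)⟩
  have hDpos : (0 : ℝ) < D := by exact_mod_cast hD1
  -- The majorant estimate for `xᵢ`, with `d = 1`, is `R ^ D * q ^ k * k!`.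
  set q : ℝ := R ^ D * (M * D) with hq
  have hq0 : 0 < q := by positivity
  have hcoeff : ∀ i k, |taylorCoeff F x₀ i k| ≤ R ^ D * q ^ k := by
    intro i k
    have h := abs_eval_iterate_monomial_le hR hx hD hM (zero_le_one.trans hM1) k 1
      (Finsupp.single i 1) (by simpa using hD1)
    rw [Nat.one_ascFactorial, abs_mul, Nat.abs_cast] at h
    have hk : (0 : ℝ) < k.factorial := by positivity
    rw [taylorCoeff_eq_lieJet]
    refine le_of_mul_le_mul_left (h.trans_eq ?_) hk
    rw [hq, mul_pow (R ^ D), mul_add, mul_one, pow_add, pow_mul]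
    ring
  refine ⟨q⁻¹, inv_pos.2 hq0, fun t ht => ?_⟩
  have hrad : ∀ i, ((Real.toNNReal q⁻¹ : NNReal) : ENNReal) ≤
      (FormalMultilinearSeries.ofScalars ℝ (taylorCoeff F x₀ i)).radius := by
    intro i
    refine FormalMultilinearSeries.le_radius_of_bound _ (R ^ D) fun k => ?_
    rw [FormalMultilinearSeries.ofScalars_norm, Real.norm_eq_abs,
      Real.coe_toNNReal _ (inv_pos.2 hq0).le]
    calc _ ≤ R ^ D * q ^ k * q⁻¹ ^ k := by gcongr; exact hcoeff i k
      _ = R ^ D := by rw [mul_assoc, ← mul_pow, mul_inv_cancel₀ hq0.ne', one_pow, mul_one]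
  refine lt_of_lt_of_le ?_ (le_iInf hrad)
  exact (ENNReal.ofReal_lt_ofReal_iff (inv_pos.2 hq0)).2 ht

/-- A polynomial vanishes along the whole trajectory through `x₀` if and only if all its iterated
Lie derivatives vanish at `x₀`. -/
theorem forall_eval_trajectory_eq_zero_iff (p : MvPolynomial (Fin N) ℝ) :
    (∀ t ∈ timeDomain F x₀, eval (trajectory F x₀ t) p = 0) ↔
      ∀ k, eval x₀ ((lieDerivation F)^[k] p) = 0 := by
  simp only [← lieJet_eq_zero_iff]
  refine ⟨fun h => ?_, fun h t ht => by simp [eval_trajectory ht, h]⟩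
  obtain ⟨r, hr, hdom⟩ := exists_pos_forall_mem_timeDomain F x₀
  -- The Lie series of `p` represents the zero function near `0`.
  have hps : HasFPowerSeriesAt (0 : ℝ → ℝ)
      (FormalMultilinearSeries.ofScalars ℝ fun k => lieJet F x₀ k p) 0 := by
    rw [hasFPowerSeriesAt_iff]
    filter_upwards [Metric.ball_mem_nhds (0 : ℝ) hr] with t ht
    have ht' := hdom t (by simpa using ht)
    have hs := (summable_norm_lieJet ht' p).of_norm.hasSum
    rw [← eval_trajectory ht' p, h t ht'] at hs
    simpa [FormalMultilinearSeries.coeff_ofScalars, mul_comm] using hs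
  have h0 := hps.eq_zero
  rw [FormalMultilinearSeries.ofScalars_series_eq_zero] at h0
  exact fun k => congrFun h0 k

/-- Safety of an algebraic postcondition, in terms of the Lie derivatives at the initial states. -/
theorem safe_variety_iff (P : Set (MvPolynomial (Fin N) ℝ)) (ψ : Set (Fin N → ℝ)) :
    Safe F ψ (variety P) ↔
      ∀ x₀ ∈ ψ, ∀ p ∈ P, ∀ k, eval x₀ ((lieDerivation F)^[k] p) = 0 := by
  simp only [← forall_eval_trajectory_eq_zero_iff]
  exact ⟨fun h x₀ hx p hp t ht => h x₀ hx t ht p hp, fun h x₀ hx t ht p hp => h x₀ hx p hp t ht⟩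

end Flow

/-! ### Templates and the invariance of the ideal returned by `post` -/

variable {n N : ℕ} (F : Fin N → MvPolynomial (Fin N) ℝ)

/-- Substituting for the parameters commutes with Lie derivation, as the parameters are treated as
constants. -/
theorem subst_lieTemplate (π : MvPolynomial (Fin n ⊕ Fin N) ℝ) (v : Fin n → ℝ) :
    subst (lieTemplate F π) v = lieDerivation F (subst π v) := by
  have h2 : ∀ a b : MvPolynomial (Fin n ⊕ Fin N) ℝ, subst (a + b) v = subst a v + subst b v :=
    fun a b => map_add _ a b
  induction π using MvPolynomial.induction_on with
  | C a => simp [lieTemplate, subst, lieDerivation, MvPolynomial.algebraMap_eq, derivation_C]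
  | add p q hp hq =>
    have h1 : lieTemplate F (p + q) = lieTemplate F p + lieTemplate F q := by
      simp [lieTemplate, add_mul, Finset.sum_add_distrib]
    rw [h1, h2, h2, hp, hq, map_add]
  | mul_X p s hp =>
    have h1 : lieTemplate F (p * X s) = lieTemplate F p * X s + p * lieTemplate F (X s) := by
      simp only [lieTemplate, Derivation.leibniz, Finset.sum_mul, Finset.mul_sum,
        ← Finset.sum_add_distrib, smul_eq_mul]
      exact Finset.sum_congr rfl fun i _ => by ring
    have h3 : ∀ a b : MvPolynomial (Fin n ⊕ Fin N) ℝ, subst (a * b) v = subst a v * subst b v :=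
      fun a b => map_mul _ a b
    have h4 : subst (lieTemplate F (X s)) v = lieDerivation F (subst (X s) v) := by
      rcases s with i | i
      · simp [lieTemplate, subst, lieDerivation, derivation_C, pderiv_X]
      · have h5 : aeval (Sum.elim (fun i => C (v i)) X) (rename Sum.inr (F i)) = F i := by
          rw [aeval_rename, Sum.elim_comp_inr, aeval_X_left_apply]
        simpa [lieTemplate, subst, lieDerivation, pderiv_X, Pi.single_apply, mkDerivation_X,
          ite_mul] using h5
    rw [h1, h2, h3, h3, h3, hp, h4, Derivation.leibniz]
    simp only [smul_eq_mul]
    ring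

theorem subst_iterate_lieTemplate (π : MvPolynomial (Fin n ⊕ Fin N) ℝ) (v : Fin n → ℝ) (j : ℕ) :
    subst ((lieTemplate F)^[j] π) v = (lieDerivation F)^[j] (subst π v) := by
  induction j with
  | zero => rfl
  | succ j ih => rw [Function.iterate_succ_apply', subst_lieTemplate, ih,
      Function.iterate_succ_apply']

variable {F}

/-- An ideal is closed under a derivation as soon as the derivation maps generators into it. -/
theorem lieDerivation_mem_span {S : Set (MvPolynomial (Fin N) ℝ)}
    (hS : ∀ p ∈ S, lieDerivation F p ∈ Ideal.span S) {p : MvPolynomial (Fin N) ℝ}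
    (hp : p ∈ Ideal.span S) : lieDerivation F p ∈ Ideal.span S := by
  induction hp using Submodule.span_induction with
  | mem p hp => exact hS p hp
  | zero => simp
  | add p q _ _ hp hq => rw [map_add]; exact add_mem hp hq
  | smul a p hp hLp =>
    rw [smul_eq_mul, Derivation.leibniz, smul_eq_mul, smul_eq_mul]
    exact add_mem (Ideal.mul_mem_left _ a hLp) (Ideal.mul_mem_right _ _ hp)

variable {m : MonomialOrder (Fin n ⊕ Fin N)} {G : Set (MvPolynomial (Fin N) ℝ)}
  {π : MvPolynomial (Fin n ⊕ Fin N) ℝ} {k : ℕ}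

theorem subst_iterate_mem_idealChain {j : ℕ} (hj : j ≤ k) {v : Fin n → ℝ}
    (hv : v ∈ paramSpace F m G π k) :
    subst ((lieTemplate F)^[j] π) v ∈ idealChain F m G π k :=
  Ideal.subset_span (Set.mem_iUnion₂.2 ⟨j, hj, v, hv, rfl⟩)

/-- At an index where both chains are stationary, the ideal is closed under the Lie derivative:
the derivative of a generator of `J_k` is a generator of `J_{k+1}`, because `V_{k+1} = V_k`. -/
theorem lieDerivation_mem_idealChain
    (hV : paramSpace F m G π (k + 1) = paramSpace F m G π k)
    (hJ : idealChain F m G π (k + 1) = idealChain F m G π k) {p : MvPolynomial (Fin N) ℝ}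
    (hp : p ∈ idealChain F m G π k) : lieDerivation F p ∈ idealChain F m G π k := by
  refine lieDerivation_mem_span (fun p hp => ?_) hp
  obtain ⟨j, hj, v, hv, rfl⟩ := Set.mem_iUnion₂.1 hp
  rw [← subst_lieTemplate, ← Function.iterate_succ_apply' (lieTemplate F)]
  have h := subst_iterate_mem_idealChain (F := F) (m := m) (G := G) (π := π)
    (Nat.succ_le_succ hj) (hV.symm ▸ hv)
  rwa [hJ] at h

/-- At any index where both chains are stationary, not only the least one, the zero set of the ideal
is the weakest precondition. -/
theorem isWeakestPrecondition_idealChain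
    (hV : paramSpace F m G π (k + 1) = paramSpace F m G π k)
    (hJ : idealChain F m G π (k + 1) = idealChain F m G π k) :
    IsWeakestPrecondition F (variety (subst π '' paramSpace F m G π k))
      (variety (idealChain F m G π k : Set (MvPolynomial (Fin N) ℝ))) := by
  refine ⟨⟨⟨_, rfl⟩, (safe_variety_iff F _ _).2 ?_⟩, fun ψ hψ x₀ hx₀ => ?_⟩
  · rintro x₀ hx₀ _ ⟨v, hv, rfl⟩ j
    refine hx₀ _ ?_
    induction j with
    | zero => exact subst_iterate_mem_idealChain (j := 0) (Nat.zero_le k) hv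
    | succ j ih =>
      rw [Function.iterate_succ_apply']
      exact lieDerivation_mem_idealChain hV hJ ih
  · have hle : idealChain F m G π k ≤ RingHom.ker (eval x₀) := by
      refine Ideal.span_le.2 fun p hp => ?_
      obtain ⟨j, -, v, hv, rfl⟩ := Set.mem_iUnion₂.1 hp
      rw [SetLike.mem_coe, RingHom.mem_ker, subst_iterate_lieTemplate]
      exact (safe_variety_iff F _ _).1 hψ.2 x₀ hx₀ _ ⟨v, hv, rfl⟩ j
    exact fun p hp => hle hp

end PolyODE


theorem theorem4 {n N : ℕ} (F : Fin N → MvPolynomial (Fin N) ℝ)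
    (m : MonomialOrder (Fin n ⊕ Fin N)) (mx : MonomialOrder (Fin N))
    (hm : PolyODE.IsEliminationOrder m mx)
    (ψ₀ : Set (Fin N → ℝ)) (hψ₀ : PolyODE.IsAlgebraicVariety ψ₀)
    (G : Set (MvPolynomial (Fin N) ℝ))
    (hG : PolyODE.IsGroebnerBasis mx G (MvPolynomial.vanishingIdeal ℝ ψ₀))
    (π : MvPolynomial (Fin n ⊕ Fin N) ℝ) (hπ : PolyODE.IsTemplate π)
    (V : Set (Fin n → ℝ)) (J : Ideal (MvPolynomial (Fin N) ℝ))
    (hVJ : PolyODE.post F m G π = (V, J)) :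
    PolyODE.IsWeakestPrecondition F (PolyODE.variety (PolyODE.subst π '' V))
      (PolyODE.variety (J : Set (MvPolynomial (Fin N) ℝ))) := by
  classical
  obtain ⟨rfl, rfl⟩ := Prod.mk.inj hVJ
  obtain ⟨hV, hJ⟩ := Nat.find_spec (PolyODE.exists_stop F m G π)
  exact PolyODE.isWeakestPrecondition_idealChain hV hJ
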